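/- Let $n\ge 2$ be an integer and let $\alpha\in\mathbb C$ be a primitive $2^n$-th root of unity (for instance $\alpha=e^{2\pi i/2^n}$). Let $P$ be the subgroup of $\mathbb Q(\alpha)^*$ generated by the numbers $1-\alpha^k$, $k\in\{1,2,\dots,2^n-1\}$, and let $$K(\alpha)=P\cap \mathbb Z[\alpha]^{\times}$$ be the group of cyclotomic (circular) units of $\mathbb Q(\alpha)$. For $j\in\mathbb Z$ put $d_j=1+\alpha^j+\alpha^{-j}$; this is a nonzero real number. Let $D$ be the multiplicative group generated by the numbers $d_{2l+1}$, $0\le l\le 2^{n-2}-2$ (so $D=1$ if $n=2$). Then the following are internal direct product decompositions: $$K(\alpha)=\langle\alpha\rangle\times\prod_{l=0}^{2^{n-2}-2}\langle d_{2l+1}\rangle,\qquad D=\prod_{l=0}^{2^{n-2}-2}\langle d_{2l+1}\rangle,$$ and in consequence $$K(\alpha)=\langle\alpha\rangle\times D,\qquad K(\alpha)\cap\mathbb R=\langle-1\rangle\times D.$$ -/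

import Mathlib

/-- In a commutative group `G`, the subgroup `N` is the (internal) direct product of the finite
family of subgroups `H i`: the multiplication map `∏ i, H i → G`, `f ↦ ∏ i, f i`, is injective
and its image is exactly `N`. -/
def IsInternalDirectProduct {G ι : Type*} [CommGroup G] [Fintype ι]
    (N : Subgroup G) (H : ι → Subgroup G) : Prop :=
  Function.Injective (fun f : (∀ i, H i) => ∏ i, (f i : G)) ∧
    Set.range (fun f : (∀ i, H i) => ∏ i, (f i : G)) = (N : Set G)

namespace TwoPowerCyclotomic

/-- The multiplicative group `P = ⟨1 - α ^ k ∣ k ∈ {1, …, 2 ^ n - 1}⟩`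
(for `α` a primitive `2 ^ n`-th root of unity every `1 - α ^ k` here is nonzero). -/
def P (n : ℕ) (α : ℂˣ) : Subgroup ℂˣ :=
  Subgroup.closure {u : ℂˣ | ∃ k : ℕ, 1 ≤ k ∧ k ≤ 2 ^ n - 1 ∧ (u : ℂ) = 1 - (α : ℂ) ^ k}

/-- The group of units of the ring `ℤ[α]`, as a subgroup of `ℂˣ`. -/
def unitsZ (α : ℂˣ) : Subgroup ℂˣ :=
  (Units.map ((Algebra.adjoin ℤ {(α : ℂ)}).val : Algebra.adjoin ℤ {(α : ℂ)} →* ℂ)).range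

/-- The group of cyclotomic units `K(α) = P ∩ ℤ[α]ˣ`. -/
def K (n : ℕ) (α : ℂˣ) : Subgroup ℂˣ := P n α ⊓ unitsZ α

/-- The nonzero real numbers, as a subgroup of `ℂˣ`. -/
def realUnits : Subgroup ℂˣ := (Units.map (Complex.ofRealHom : ℝ →* ℂ)).range

theorem d_ne_zero {n : ℕ} {α : ℂˣ} (hα : IsPrimitiveRoot α (2 ^ n)) (j : ℤ) :
    (1 : ℂ) + (α : ℂ) ^ j + (α : ℂ) ^ (-j) ≠ 0 := by
  intro h
  have hx0 : (α : ℂ) ^ j ≠ 0 := zpow_ne_zero _ α.ne_zero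
  rw [zpow_neg] at h
  have hα1 : (α : ℂ) ^ (2 ^ n) = 1 := by
    rw [← Units.val_pow_eq_pow_val, hα.pow_eq_one, Units.val_one]
  have h2 : ((α : ℂ) ^ j) ^ (2 ^ n) = 1 := by
    rw [← zpow_natCast, zpow_comm, zpow_natCast, hα1, one_zpow]
  generalize (α : ℂ) ^ j = x at *
  field_simp at h
  have h3 : x ^ 3 = 1 := by linear_combination (x - 1) * h
  have hc : Nat.Coprime (2 ^ n) 3 := Nat.Coprime.pow_left n (by norm_num)
  have hx : x = 1 := by
    have h4 := pow_gcd_eq_one.mpr ⟨h2, h3⟩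
    rwa [hc.gcd_eq_one, pow_one] at h4
  subst hx
  norm_num at h

/-- The nonzero number `d_j = 1 + α ^ j + α ^ (-j)`, for `j ∈ ℤ`. -/
noncomputable def d {n : ℕ} {α : ℂˣ} (hα : IsPrimitiveRoot α (2 ^ n)) (j : ℤ) : ℂˣ :=
  Units.mk0 (1 + (α : ℂ) ^ j + (α : ℂ) ^ (-j)) (d_ne_zero hα j)

/-- The group `D` generated by the `d_{2l+1}`, `l ∈ {0, …, 2 ^ (n-2) - 2}`. -/
def D {n : ℕ} {α : ℂˣ} (hα : IsPrimitiveRoot α (2 ^ n)) : Subgroup ℂˣ :=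
  Subgroup.closure (Set.range fun l : Fin (2 ^ (n - 2) - 1) => d hα (2 * (l : ℕ) + 1))

end TwoPowerCyclotomic

/-! Write `n = m + 2`. Modulo `2 ^ n` and up to sign, the odd residues are the powers `3 ^ i`, `i <
2 ^ m`, so the `d_{2l+1}`, `l < 2 ^ m`, are the Galois conjugates of `d_1`.

Generation: `1 - x ^ 3 = (1 - x) * x * (1 + x + x⁻¹)` telescopes along the powers of 3, and `1 - x ^
2 = (1 - x) * (1 + x)` handles even exponents. Hence `P` lies in `⟨α⟩ D ⟨1 - α⟩`. Telescoping round
the full cycle puts the product of all `2 ^ m` conjugates in `⟨α⟩`, so the last one may be dropped.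
Since 2 is a unit times a power of `1 - α`, no nontrivial power of `1 - α` is a unit.

Independence: conjugating a relation and taking `log ‖·‖` gives `B(E) f = 0`, with `E` the cyclic
shift, `B` the polynomial of exponents and `f` the logarithms of the conjugates. Each irreducible
factor `X ^ 2 ^ k + 1` of `X ^ 2 ^ m - 1` must divide `B`; otherwise the trace of `f` to a subfield
would have too short a period, forcing `‖1 - x - x⁻¹‖ = ‖1 + x + x⁻¹‖` for some `x` of order at
least 8. So `B` is a multiple of `1 + X + ⋯ + X ^ (2 ^ m - 1)`: all exponents agree, and the dropped
one is 0. -/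

/-! ### Rational recurrences and the shift operator -/

open Polynomial in
/-- A sequence `f m`, periodic of period `2 ^ m`, whose relative traces `f k` satisfy
`f (k + 1) (2 ^ k) ≠ f (k + 1) 0`, satisfies no rational recurrence of length `2 ^ m` except for
the ones with constant coefficients. -/
theorem coeff_eq_of_shift_relation (m : ℕ) (f : ℕ → ℕ → ℝ)
    (hf : ∀ k < m, ∀ i, f k i = f (k + 1) (i + 2 ^ k) + f (k + 1) i)
    (hne : ∀ k < m, f (k + 1) (2 ^ k) ≠ f (k + 1) 0)
    (hper : ∀ i, f m (i + 2 ^ m) = f m i) (b : ℕ → ℚ)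
    (hb : ∀ r, ∑ i ∈ Finset.range (2 ^ m), (b i : ℝ) * f m (i + r) = 0) :
    ∀ i < 2 ^ m, b i = b 0 := by
  let E : Module.End ℚ (ℕ → ℝ) :=
    { toFun := fun u i => u (i + 1), map_add' := fun _ _ => rfl, map_smul' := fun _ _ => rfl }
  have hE : ∀ (r : ℕ) (u : ℕ → ℝ) (i : ℕ), (E ^ r) u i = u (i + r) := by
    intro r
    induction r with
    | zero => intro u i; simp
    | succ r ih =>
      intro u i
      rw [pow_succ, Module.End.mul_apply, ih]
      rfl
  set B : ℚ[X] := ∑ i ∈ Finset.range (2 ^ m), C (b i) * X ^ i with hB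
  have hBu : aeval E B (f m) = 0 := by
    ext r
    have := hb r
    simp only [hB, map_sum, map_mul, aeval_C, map_pow, aeval_X, LinearMap.sum_apply,
      Finset.sum_apply, Module.End.mul_apply, Module.algebraMap_end_apply, Pi.smul_apply, hE,
      Pi.zero_apply, Rat.smul_def]
    rw [← this]
    exact Finset.sum_congr rfl fun i _ => by rw [add_comm r i]
  -- the relative traces are obtained by applying a polynomial in the shift
  have htr : ∀ c k, k + c = m →
      aeval E (∏ j ∈ Finset.Ico k m, (X ^ 2 ^ j + 1 : ℚ[X])) (f m) = f k := by
    intro c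
    induction c with
    | zero => intro k hk; obtain rfl : k = m := by omega
              simp
    | succ c ih =>
      intro k hk
      have hk' : k < m := by omega
      rw [Finset.prod_eq_prod_Ico_succ_bot hk', map_mul, Module.End.mul_apply,
        ih (k + 1) (by omega)]
      ext i
      simp [hE, hf k hk']
  have hfac : ∀ c k, k + c = m →
      (X ^ 2 ^ k - 1 : ℚ[X]) * ∏ j ∈ Finset.Ico k m, (X ^ 2 ^ j + 1 : ℚ[X]) = X ^ 2 ^ m - 1 := by
    intro c
    induction c with
    | zero => intro k hk; obtain rfl : k = m := by omega
              simp
    | succ c ih =>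
      intro k hk
      rw [Finset.prod_eq_prod_Ico_succ_bot (by omega : k < m), ← ih (k + 1) (by omega)]
      ring
  have hirr : ∀ k, Irreducible (X ^ 2 ^ k + 1 : ℚ[X]) := by
    intro k
    have h := cyclotomic.irreducible_rat (n := 2 ^ (k + 1)) (by positivity)
    rw [cyclotomic_prime_pow_eq_geom_sum Nat.prime_two] at h
    simpa [Finset.sum_range_succ, add_comm] using h
  have hdvd : ∀ k < m, (X ^ 2 ^ k + 1 : ℚ[X]) ∣ B := by
    intro k hk
    by_contra hnd
    obtain ⟨s, t, hst⟩ := ((hirr k).coprime_iff_not_dvd).2 hnd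
    -- This is `(X ^ 2 ^ m - 1) / (X ^ 2 ^ k + 1)`. By Bézout it also annihilates `f m`, whereas its
    -- action on `f m` is that of `E ^ 2 ^ k - 1` on `f (k + 1)`.
    set q : ℚ[X] := (X ^ 2 ^ k - 1) * ∏ j ∈ Finset.Ico (k + 1) m, (X ^ 2 ^ j + 1 : ℚ[X])
    have h1 : aeval E ((X ^ 2 ^ k + 1) * q) (f m) = 0 := by
      have : (X ^ 2 ^ k + 1) * q = X ^ 2 ^ m - 1 := by
        rw [← hfac (m - k) k (by omega), Finset.prod_eq_prod_Ico_succ_bot hk]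
        ring
      rw [this]
      ext i
      simp [hE, hper]
    have h2 : aeval E q (f m) = 0 := by
      have : q = s * ((X ^ 2 ^ k + 1) * q) + (q * t) * B := by
        linear_combination (-q) * hst
      rw [this, map_add, map_mul _ s, map_mul _ _ B, LinearMap.add_apply, Module.End.mul_apply,
        Module.End.mul_apply, h1, hBu]
      simp
    have h3 := congrFun h2 0
    rw [map_mul, Module.End.mul_apply, htr (m - (k + 1)) (k + 1) (by omega)] at h3
    simp [hE, sub_eq_zero] at h3
    exact hne k hk h3
  have hprod : (∏ k ∈ Finset.Ico 0 m, (X ^ 2 ^ k + 1 : ℚ[X])) ∣ B := by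
    refine Finset.prod_dvd_of_coprime ?_ fun k hk => hdvd k (Finset.mem_Ico.1 hk).2
    have key : ∀ i j : ℕ, i < j → IsCoprime (X ^ 2 ^ i + 1 : ℚ[X]) (X ^ 2 ^ j + 1) := by
      intro i j hij
      refine ((hirr i).coprime_iff_not_dvd).2 fun h => ?_
      -- A common factor of `X ^ 2 ^ j + 1` and `X ^ 2 ^ j - 1` divides the unit 2.
      have h' : (X ^ 2 ^ i + 1 : ℚ[X]) ∣ X ^ 2 ^ j - 1 := by
        have h4 : (X ^ 2 ^ i + 1 : ℚ[X]) ∣ X ^ 2 ^ (i + 1) - 1 :=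
          ⟨X ^ 2 ^ i - 1, by ring⟩
        refine h4.trans ?_
        obtain ⟨c, rfl⟩ := Nat.exists_eq_add_of_le (Nat.succ_le_of_lt hij)
        rw [pow_add 2 i.succ, pow_mul]
        have h6 := sub_dvd_pow_sub_pow (X ^ 2 ^ (i + 1) : ℚ[X]) 1 (2 ^ c)
        rwa [one_pow] at h6
      have h5 : (X ^ 2 ^ i + 1 : ℚ[X]) ∣ C 2 := by
        have := dvd_sub h h'
        rwa [show (X ^ 2 ^ j + 1 - (X ^ 2 ^ j - 1) : ℚ[X]) = C 2 by
          rw [map_ofNat]; ring] at this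
      exact (hirr i).not_isUnit
        (isUnit_of_dvd_unit h5 (isUnit_C.2 (by norm_num)))
    intro i _ j _ hij
    rcases lt_or_gt_of_ne hij with h | h
    · exact key i j h
    · exact (key j i h).symm
  have hgeom : (∏ k ∈ Finset.Ico 0 m, (X ^ 2 ^ k + 1 : ℚ[X])) =
      ∑ i ∈ Finset.range (2 ^ m), X ^ i := by
    have h := hfac m 0 (by omega)
    rw [pow_zero, pow_one, ← mul_geom_sum] at h
    exact mul_left_cancel₀ (X_sub_C_ne_zero (1 : ℚ)) (by simpa using h)
  have hcoeff : ∀ i < 2 ^ m, B.coeff i = b i := by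
    intro i hi
    simp [hB, coeff_X_pow, hi]
  have hBdeg : B.degree < (2 ^ m : ℕ) := by
    rw [degree_lt_iff_coeff_zero]
    intro i hi
    simp only [hB, finsetSum_coeff, coeff_C_mul, coeff_X_pow]
    refine Finset.sum_eq_zero fun j hj => ?_
    rw [if_neg (by have := Finset.mem_range.1 hj; omega), mul_zero]
  set G : ℚ[X] := ∑ i ∈ Finset.range (2 ^ m), X ^ i with hG
  have hGcoeff : ∀ i < 2 ^ m, G.coeff i = 1 := by
    intro i hi
    simp [hG, coeff_X_pow, hi]
  rw [hgeom] at hprod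
  obtain ⟨Q, hQ⟩ := hprod
  have hpos : 0 < 2 ^ m := by positivity
  have hQC : ∃ c, Q = C c := by
    by_cases hQ0 : Q = 0
    · exact ⟨0, by simp [hQ0]⟩
    refine ⟨Q.coeff 0, eq_C_of_natDegree_eq_zero ?_⟩
    have hG0 : G ≠ 0 := fun h => by simpa [h] using hGcoeff 0 hpos
    have h1 : 2 ^ m - 1 ≤ G.natDegree :=
      le_natDegree_of_ne_zero (by rw [hGcoeff _ (by omega)]; exact one_ne_zero)
    have h2 : B.natDegree < 2 ^ m :=
      (natDegree_lt_iff_degree_lt (hQ ▸ mul_ne_zero hG0 hQ0)).2 hBdeg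
    rw [hQ, natDegree_mul hG0 hQ0] at h2
    omega
  obtain ⟨c, rfl⟩ := hQC
  intro i hi
  rw [← hcoeff i hi, ← hcoeff 0 hpos, hQ, coeff_mul_C, coeff_mul_C, hGcoeff i hi, hGcoeff 0 hpos]

theorem IsInternalDirectProduct.of_forall {G ι : Type*} [CommGroup G] [Fintype ι]
    {N : Subgroup G} {H : ι → Subgroup G}
    (hinj : ∀ f : ι → G, (∀ i, f i ∈ H i) → ∏ i, f i = 1 → ∀ i, f i = 1)
    (hmem : ∀ x, x ∈ N ↔ ∃ f : ι → G, (∀ i, f i ∈ H i) ∧ ∏ i, f i = x) :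
    IsInternalDirectProduct N H := by
  constructor
  · intro f g hfg
    ext i
    have h := hinj (fun i => (f i : G) / g i) (fun i => (H i).div_mem (f i).2 (g i).2)
      (by rw [Finset.prod_div_distrib]; exact div_eq_one.2 hfg) i
    exact div_eq_one.1 h
  · ext x
    rw [SetLike.mem_coe, hmem]
    constructor
    · rintro ⟨f, rfl⟩
      exact ⟨fun i => f i, fun i => (f i).2, rfl⟩
    · rintro ⟨f, hf, rfl⟩
      exact ⟨fun i => ⟨f i, hf i⟩, rfl⟩

/-! ### Powers of 3 modulo powers of 2 -/

/-- Squaring `±1 + 2 ^ (m + 2) * c` preserves the shape and the oddness of `c`. The minus sign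
occurs only at `m = 0`. -/
theorem three_pow_two_pow (m : ℕ) :
    ∃ c : ℤ, Odd c ∧ ((3 : ℤ) ^ 2 ^ m = 1 + 2 ^ (m + 2) * c ∨
      (3 : ℤ) ^ 2 ^ m = -1 + 2 ^ (m + 2) * c) := by
  induction m with
  | zero => exact ⟨1, odd_one, Or.inr (by norm_num)⟩
  | succ m ih =>
    obtain ⟨c, hc, h⟩ := ih
    have he : Even ((2 : ℤ) ^ (m + 1) * c ^ 2) := by
      rw [pow_succ]
      exact ⟨2 ^ m * c ^ 2, by ring⟩
    rcases h with h | h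
    · refine ⟨c + 2 ^ (m + 1) * c ^ 2, hc.add_even he, Or.inl ?_⟩
      rw [pow_succ, pow_mul, h]
      ring
    · refine ⟨-c + 2 ^ (m + 1) * c ^ 2, hc.neg.add_even he, Or.inl ?_⟩
      rw [pow_succ, pow_mul, h]
      ring

/-- The powers of `3` represent all odd residues modulo `2 ^ (m + 2)` up to sign. -/
theorem exists_three_pow_dvd (m : ℕ) (a : ℤ) (ha : Odd a) :
    ∃ i < 2 ^ m, (2 : ℤ) ^ (m + 2) ∣ 3 ^ i - a ∨ (2 : ℤ) ^ (m + 2) ∣ 3 ^ i + a := by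
  induction m with
  | zero =>
    obtain ⟨c, rfl⟩ := ha
    refine ⟨0, by norm_num, ?_⟩
    norm_num
    omega
  | succ m ih =>
    have key : ∀ a : ℤ, ∀ i < 2 ^ m, (2 : ℤ) ^ (m + 2) ∣ 3 ^ i - a →
        ∃ i < 2 ^ (m + 1), (2 : ℤ) ^ (m + 1 + 2) ∣ 3 ^ i - a ∨
          (2 : ℤ) ^ (m + 1 + 2) ∣ 3 ^ i + a := by
      rintro a i hi ⟨q, hq⟩
      have h3 : Odd ((3 : ℤ) ^ i) := Odd.pow (by decide)
      rcases Int.even_or_odd q with ⟨r, rfl⟩ | hodd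
      · exact ⟨i, by rw [pow_succ]; omega, Or.inl ⟨r, by rw [hq]; ring⟩⟩
      -- Multiplying `3 ^ i` by `3 ^ 2 ^ m` changes it, up to sign, by an odd multiple of `2 ^ (m +
      -- 2)`, which makes the odd quotient `q` even.
      · obtain ⟨c, hc, h⟩ := three_pow_two_pow m
        refine ⟨i + 2 ^ m, by rw [pow_succ]; omega, ?_⟩
        rcases h with h | h
        · left
          obtain ⟨r, hr⟩ := hodd.add_odd (h3.mul hc)
          exact ⟨r, by rw [pow_add, h]; linear_combination hq + 2 ^ (m + 2) * hr⟩
        · right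
          obtain ⟨r, hr⟩ := hodd.neg.add_odd (h3.mul hc)
          exact ⟨r, by rw [pow_add, h]; linear_combination -hq + 2 ^ (m + 2) * hr⟩
    obtain ⟨i, hi, h | h⟩ := ih
    · exact key a i hi h
    · obtain ⟨j, hj, h⟩ := key (-a) i hi (by rwa [sub_neg_eq_add])
      exact ⟨j, hj, by simpa [sub_eq_add_neg, or_comm] using h⟩

/-! ### Roots of unity of 2-power order -/

/-- A zero would be a cube root of unity of 2-power order, hence 1, but `1 + 1 + 1 ≠ 0`. -/
theorem one_add_add_inv_ne_zero {x : ℂ} {n : ℕ} (hx : x ^ 2 ^ n = 1) : 1 + x + x⁻¹ ≠ 0 := by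
  intro h
  have hx0 : x ≠ 0 := by
    rintro rfl
    simp at hx
  field_simp at h
  have h3 : x ^ 3 = 1 := by linear_combination (x - 1) * h
  have h4 := pow_gcd_eq_one.mpr ⟨hx, h3⟩
  rw [(Nat.Coprime.pow_left n (by norm_num) : Nat.Coprime (2 ^ n) 3).gcd_eq_one, pow_one] at h4
  subst h4
  norm_num at h

theorem inv_inv_add_comm (x : ℂ) : 1 + x⁻¹ + x⁻¹⁻¹ = 1 + x + x⁻¹ := by
  rw [inv_inv]; ring

theorem IsPrimitiveRoot.pow_two_pow_half {x : ℂ} {n : ℕ} (hx : IsPrimitiveRoot x (2 ^ (n + 1))) :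
    x ^ 2 ^ n = -1 := by
  have h1 : (x ^ 2 ^ n) ^ 2 = 1 := by rw [← pow_mul, ← pow_succ, hx.pow_eq_one]
  rcases eq_or_eq_neg_of_sq_eq_sq (x ^ 2 ^ n) 1 (by rw [h1, one_pow]) with h | h
  · have := Nat.le_of_dvd (by positivity) (hx.dvd_of_pow_eq_one _ h)
    rw [pow_succ] at this
    have : 0 < 2 ^ n := by positivity
    omega
  · exact h

/-- The effect of raising to the power `3 ^ 2 ^ k` on roots of unity of order `2 ^ (k + 3)`. -/
theorem pow_three_pow_two_pow_eq_neg {x : ℂ} {k : ℕ} (hx : x ^ 2 ^ (k + 2) = -1) :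
    x ^ 3 ^ 2 ^ k = -x ∨ x ^ 3 ^ 2 ^ k = -x⁻¹ := by
  have hx0 : x ≠ 0 := by
    rintro rfl
    simp at hx
  obtain ⟨c, hc, h | h⟩ := three_pow_two_pow k
  all_goals
    have h1 : x ^ 3 ^ 2 ^ k = x ^ ((3 : ℤ) ^ 2 ^ k) := by
      rw [← zpow_natCast]; push_cast; rfl
    have h2 : x ^ ((2 : ℤ) ^ (k + 2) * c) = -1 := by
      rw [zpow_mul, show x ^ ((2 : ℤ) ^ (k + 2)) = -1 by
        rw [← hx, ← zpow_natCast]; push_cast; rfl, hc.neg_one_zpow]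
    rw [h1, h, zpow_add₀ hx0, h2]
  · left; simp
  · right; simp

theorem pow_three_pow_two_pow_eq {x : ℂ} {k : ℕ} (hx : x ^ 2 ^ (k + 2) = 1) :
    x ^ 3 ^ 2 ^ k = x ∨ x ^ 3 ^ 2 ^ k = x⁻¹ := by
  have hx0 : x ≠ 0 := by
    rintro rfl
    simp at hx
  obtain ⟨c, hc, h | h⟩ := three_pow_two_pow k
  all_goals
    have h1 : x ^ 3 ^ 2 ^ k = x ^ ((3 : ℤ) ^ 2 ^ k) := by
      rw [← zpow_natCast]; push_cast; rfl
    have h2 : x ^ ((2 : ℤ) ^ (k + 2) * c) = 1 := by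
      rw [zpow_mul, show x ^ ((2 : ℤ) ^ (k + 2)) = 1 by
        rw [← hx, ← zpow_natCast]; push_cast; rfl, one_zpow]
    rw [h1, h, zpow_add₀ hx0, h2]
  · left; simp
  · right; simp

/-! ### Multiplicative relations between conjugates -/

/-- A multiplicative relation between `α` and the numbers `1 + α ^ e + α ^ (-e)` persists when `α`
is replaced by a conjugate. -/
theorem conj_relation {n : ℕ} {α : ℂ} (hα : IsPrimitiveRoot α (2 ^ n)) (s : ℤ) {ι : Type*}
    (S : Finset ι) (e : ι → ℕ) (b : ι → ℤ)
    (h : α ^ s * ∏ i ∈ S, (1 + α ^ e i + (α ^ e i)⁻¹) ^ b i = 1) {t : ℕ} (ht : Odd t) :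
    (α ^ t) ^ s * ∏ i ∈ S, (1 + (α ^ t) ^ e i + ((α ^ t) ^ e i)⁻¹) ^ b i = 1 := by
  have hpos : 0 < 2 ^ n := by positivity
  have hcop : Nat.Coprime t (2 ^ n) := (Nat.coprime_two_right.2 ht).pow_right n
  have hint : IsIntegral ℚ α := (hα.isIntegral hpos).tower_top
  have hroot : α ^ t ∈ (minpoly ℚ α).aroots ℂ := by
    rw [Polynomial.mem_aroots]
    refine ⟨minpoly.ne_zero hint, ?_⟩
    have hα' := hα.pow_of_coprime t hcop
    rw [← Polynomial.cyclotomic_eq_minpoly_rat hα hpos,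
      Polynomial.cyclotomic_eq_minpoly_rat hα' hpos]
    exact minpoly.aeval _ _
  set g := IntermediateField.AdjoinSimple.gen ℚ α
  have hg : (g : ℂ) = α := IntermediateField.AdjoinSimple.coe_gen ℚ α
  -- The embedding of `ℚ(α)` in `ℂ` with `α ↦ α ^ t`; it exists because both have the same
  -- cyclotomic minimal polynomial.
  let φ := (IntermediateField.algHomAdjoinIntegralEquiv ℚ hint).symm ⟨_, hroot⟩
  have hφ : φ g = α ^ t :=
    IntermediateField.algHomAdjoinIntegralEquiv_symm_apply_gen ℚ hint _
  have hK : g ^ s * ∏ i ∈ S, (1 + g ^ e i + (g ^ e i)⁻¹) ^ b i = 1 := by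
    apply (algebraMap (IntermediateField.adjoin ℚ {α}) ℂ).injective
    simp only [map_mul, map_zpow₀, map_prod, map_add, map_one, map_pow, map_inv₀]
    have hg' : algebraMap (IntermediateField.adjoin ℚ {α}) ℂ g = α := hg
    rw [hg']
    exact h
  have := congrArg φ hK
  simpa only [map_mul, map_zpow₀, map_prod, map_add, map_one, map_pow, map_inv₀, hφ] using this

/-- As `x + x⁻¹ = 2 Re x`, equality would give `Re x = 0`, so `x ^ 4 = 1`, contradicting order at
least 8. -/
theorem norm_one_sub_sub_inv_ne {x : ℂ} {k : ℕ} (hx : IsPrimitiveRoot x (2 ^ (k + 3))) :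
    ‖1 - x - x⁻¹‖ ≠ ‖1 + x + x⁻¹‖ := by
  intro h
  have hnorm : ‖x‖ = 1 := hx.norm'_eq_one (by positivity)
  have hinv : x⁻¹ = starRingEnd ℂ x := by
    rw [Complex.inv_def, Complex.normSq_eq_norm_sq, hnorm]; simp
  have hsum : x + x⁻¹ = ((2 * x.re : ℝ) : ℂ) := by rw [hinv, Complex.add_conj]
  have hre : x.re = 0 := by
    rw [sub_sub, add_assoc, hsum, ← Complex.ofReal_one, ← Complex.ofReal_sub, ← Complex.ofReal_add,
      Complex.norm_real, Complex.norm_real, Real.norm_eq_abs, Real.norm_eq_abs,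
      ← sq_eq_sq_iff_abs_eq_abs] at h
    linarith
  rw [hre, mul_zero, Complex.ofReal_zero] at hsum
  have hx0 : x ≠ 0 := hx.ne_zero (by positivity)
  have h2 : x ^ 2 = -1 := by
    field_simp at hsum
    linear_combination hsum
  have h4 : x ^ 4 = 1 := by linear_combination (x ^ 2 - 1) * h2
  have h5 := Nat.le_of_dvd (by norm_num) (hx.dvd_of_pow_eq_one 4 h4)
  have : 0 < 2 ^ k := by positivity
  rw [pow_add] at h5
  omega

/-- The conjugates of `1 + α + α⁻¹` satisfy no multiplicative relation modulo roots of unity except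
for the powers of the norm relation. -/
theorem exponent_eq_of_relation {m : ℕ} {α : ℂ} (hα : IsPrimitiveRoot α (2 ^ (m + 2))) (s : ℤ)
    (b : ℕ → ℤ)
    (h : α ^ s * ∏ i ∈ Finset.range (2 ^ m), (1 + α ^ 3 ^ i + (α ^ 3 ^ i)⁻¹) ^ b i = 1) :
    ∀ i < 2 ^ m, b i = b 0 := by
  -- Level `k` of the tower: `α ^ 2 ^ (m - k)` has order `2 ^ (k + 2)`, and level `m` is `α` itself.
  set f : ℕ → ℕ → ℝ := fun k i =>
    Real.log ‖1 + (α ^ 2 ^ (m - k)) ^ 3 ^ i + ((α ^ 2 ^ (m - k)) ^ 3 ^ i)⁻¹‖ with hf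
  have hprim : ∀ k < m, IsPrimitiveRoot (α ^ 2 ^ (m - (k + 1))) (2 ^ (k + 3)) := by
    intro k hk
    refine hα.pow (by positivity) ?_
    rw [← pow_add]
    congr 1
    omega
  have hα1 := hα.pow_eq_one
  have hne0 : ∀ j : ℕ, 1 + α ^ j + (α ^ j)⁻¹ ≠ 0 := fun j =>
    one_add_add_inv_ne_zero (n := m + 2) (by rw [← pow_mul, mul_comm, pow_mul, hα1, one_pow])
  have hshift : ∀ k < m, ∀ i, f (k + 1) (i + 2 ^ k) =
      Real.log ‖1 - (α ^ 2 ^ (m - (k + 1))) ^ 3 ^ i - ((α ^ 2 ^ (m - (k + 1))) ^ 3 ^ i)⁻¹‖ := by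
    intro k hk i
    simp only [hf]
    have hp := (hprim k hk).pow_two_pow_half
    generalize α ^ 2 ^ (m - (k + 1)) = x at hp
    have h3 : Odd (3 ^ i) := Odd.pow (by decide)
    have hp' : (x ^ 3 ^ i) ^ 2 ^ (k + 2) = -1 := by
      rw [← pow_mul, mul_comm, pow_mul, hp, h3.neg_one_pow]
    rw [pow_add, pow_mul]
    congr 2
    rcases pow_three_pow_two_pow_eq_neg hp' with h | h <;> rw [h]
    · rw [inv_neg]; ring
    · rw [inv_neg, inv_inv]; ring
  refine fun i hi => ?_
  have main := coeff_eq_of_shift_relation m f ?_ ?_ ?_ (fun i => (b i : ℚ)) ?_ i hi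
  · exact_mod_cast main
  · intro k hk i
    rw [hshift k hk i]
    simp only [hf]
    have h2 : α ^ 2 ^ (m - k) = (α ^ 2 ^ (m - (k + 1))) ^ 2 := by
      rw [← pow_mul, ← pow_succ]
      congr 2
      omega
    have hp := (hprim k hk).pow_two_pow_half
    rw [h2, ← pow_mul, mul_comm 2, pow_mul]
    have hx : ((α ^ 2 ^ (m - (k + 1))) ^ 3 ^ i) ^ 2 ^ (k + 3) = 1 := by
      rw [← pow_mul, mul_comm, pow_mul, (hprim k hk).pow_eq_one, one_pow]
    generalize (α ^ 2 ^ (m - (k + 1))) ^ 3 ^ i = x at hx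
    have hx0 : x ≠ 0 := by
      rintro rfl
      simp at hx
    have hneg : 1 - x - x⁻¹ ≠ 0 := by
      have := one_add_add_inv_ne_zero (x := -x) (n := k + 3)
        (by rw [Even.neg_pow (by simp [Nat.even_pow]), hx])
      rw [inv_neg] at this
      intro h0
      apply this
      rw [← h0]; ring
    -- The trace relation is `(1 - x - x⁻¹) * (1 + x + x⁻¹) = -(1 + x ^ 2 + x⁻² )`.
    rw [← Real.log_mul (norm_ne_zero_iff.2 hneg)
      (norm_ne_zero_iff.2 (one_add_add_inv_ne_zero hx)), ← norm_mul, ← norm_neg]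
    congr 2
    field_simp
    ring
  · intro k hk
    have := hshift k hk 0
    rw [zero_add] at this
    rw [this]
    simp only [hf, pow_zero, pow_one]
    intro hlog
    refine norm_one_sub_sub_inv_ne (hprim k hk) (Real.log_injOn_pos ?_ ?_ hlog)
    · refine norm_pos_iff.2 fun h0 => ?_
      have := one_add_add_inv_ne_zero (x := -(α ^ 2 ^ (m - (k + 1)))) (n := k + 3)
        (by rw [Even.neg_pow (by simp [Nat.even_pow]), (hprim k hk).pow_eq_one])
      apply this
      rw [← h0, inv_neg]; ring
    · exact norm_pos_iff.2 (hne0 _)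
  · intro i
    simp only [hf, Nat.sub_self, pow_zero, pow_one]
    have hx : (α ^ 3 ^ i) ^ 2 ^ (m + 2) = 1 := by
      rw [← pow_mul, mul_comm, pow_mul, hα1, one_pow]
    rw [pow_add, pow_mul]
    rcases pow_three_pow_two_pow_eq hx with h | h <;> rw [h]
    rw [inv_inv_add_comm]
  · intro r
    -- Conjugating by `α ↦ α ^ 3 ^ r` shifts the index by `r`; the norm removes the root of unity.
    have hconj := conj_relation hα s _ (fun i => 3 ^ i) b h (t := 3 ^ r) (Odd.pow (by decide))
    have hnorm : ‖α‖ = 1 := hα.norm'_eq_one (by positivity)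
    have hlog := congrArg (fun z : ℂ => Real.log ‖z‖) hconj
    simp only [norm_mul, norm_zpow, norm_pow, hnorm, one_pow, one_zpow, one_mul, norm_prod,
      norm_one, Real.log_one] at hlog
    rw [Real.log_prod] at hlog
    · rw [← hlog]
      refine Finset.sum_congr rfl fun i _ => ?_
      simp only [hf, Nat.sub_self, pow_zero, pow_one]
      rw [Real.log_zpow, pow_add, mul_comm (3 ^ i), pow_mul]
      simp
    · intro i _
      refine zpow_ne_zero _ (norm_ne_zero_iff.2 ?_)
      rw [← pow_mul]
      exact hne0 _

/-! ### Independence of the `d_{2l+1}` -/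

namespace TwoPowerCyclotomic

theorem d_val {n : ℕ} {α : ℂˣ} (hα : IsPrimitiveRoot α (2 ^ n)) (j : ℤ) :
    (d hα j : ℂ) = 1 + (α : ℂ) ^ j + ((α : ℂ) ^ j)⁻¹ := by
  rw [d, Units.val_mk0, zpow_neg]

theorem d_eq_of_dvd {n : ℕ} {α : ℂˣ} (hα : IsPrimitiveRoot α (2 ^ n)) {a b : ℤ}
    (h : (2 : ℤ) ^ n ∣ a - b ∨ (2 : ℤ) ^ n ∣ a + b) : d hα a = d hα b := by
  have hα' : IsPrimitiveRoot (α : ℂ) (2 ^ n) := IsPrimitiveRoot.coe_units_iff.2 hα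
  have hα0 : (α : ℂ) ≠ 0 := α.ne_zero
  ext
  rw [d_val, d_val]
  rcases h with h | h
  · have h1 := (hα'.zpow_eq_one_iff_dvd _).2 (by exact_mod_cast h)
    rw [zpow_sub₀ hα0, div_eq_one_iff_eq (zpow_ne_zero _ hα0)] at h1
    rw [h1]
  · have h1 := (hα'.zpow_eq_one_iff_dvd _).2 (by exact_mod_cast h)
    rw [zpow_add₀ hα0] at h1
    rw [eq_inv_of_mul_eq_one_left h1, inv_inv_add_comm]

/-- Each `2 * l + 1` is congruent to some `±3 ^ i`. This assignment is injective because the numbers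
`2 * l + 1`, `l < 2 ^ m`, are pairwise distinct modulo `2 ^ (m + 2)` up to sign. -/
theorem exists_equiv_d_three_pow {m : ℕ} {α : ℂˣ} (hα : IsPrimitiveRoot α (2 ^ (m + 2))) :
    ∃ e : Fin (2 ^ m) ≃ Fin (2 ^ m), ∀ l,
      d hα (3 ^ (e l : ℕ)) = d hα (2 * (l : ℕ) + 1) := by
  choose g hg hdvd using fun l : Fin (2 ^ m) =>
    exists_three_pow_dvd m (2 * (l : ℕ) + 1 : ℤ) ⟨_, rfl⟩
  have hinj : Function.Injective (fun l => (⟨g l, hg l⟩ : Fin (2 ^ m))) := by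
    intro l l' h
    have h' : g l = g l' := congrArg Fin.val h
    have h1 := hdvd l
    have h2 := hdvd l'
    rw [h'] at h1
    have hl := l.2
    have hl' := l'.2
    have hN : (2 : ℤ) ^ (m + 2) = 4 * ((2 ^ m : ℕ) : ℤ) := by push_cast; ring
    rw [hN] at h1 h2
    have hk : (4 * ((2 ^ m : ℕ) : ℤ) ∣ 2 * (l : ℕ) - 2 * (l' : ℕ)) ∨
        (4 * ((2 ^ m : ℕ) : ℤ) ∣ 2 * (l : ℕ) + 2 * (l' : ℕ) + 2) := by
      rcases h1 with ⟨p, hp⟩ | ⟨p, hp⟩ <;> rcases h2 with ⟨q, hq⟩ | ⟨q, hq⟩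
      · exact Or.inl ⟨q - p, by linear_combination hq - hp⟩
      · exact Or.inr ⟨q - p, by linear_combination hq - hp⟩
      · exact Or.inr ⟨p - q, by linear_combination hp - hq⟩
      · exact Or.inl ⟨p - q, by linear_combination hp - hq⟩
    ext
    rcases hk with hk | hk
    · have := Int.eq_zero_of_abs_lt_dvd hk (by rw [abs_lt]; constructor <;> omega)
      omega
    · have := Int.le_of_dvd (by omega) hk
      omega
  exact ⟨Equiv.ofBijective _ (Finite.injective_iff_bijective.1 hinj),
    fun l => d_eq_of_dvd hα (hdvd l)⟩

/-- The `d_{2l+1}`, `l < 2 ^ m - 1`, are multiplicatively independent modulo powers of `α`. -/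
theorem exponent_eq_zero {m : ℕ} {α : ℂˣ} (hα : IsPrimitiveRoot α (2 ^ (m + 2))) (s : ℤ)
    (a : ℕ → ℤ)
    (h : α ^ s * ∏ l ∈ Finset.range (2 ^ m - 1), d hα (2 * (l : ℕ) + 1) ^ a l = 1) :
    ∀ l < 2 ^ m - 1, a l = 0 := by
  obtain ⟨e, he⟩ := exists_equiv_d_three_pow hα
  have hpos : 0 < 2 ^ m := by positivity
  -- The omitted index `2 ^ m - 1` gets exponent 0; this is what forces the common exponent to
  -- vanish.
  set a' : ℕ → ℤ := fun l => if l < 2 ^ m - 1 then a l else 0 with ha'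
  set b : ℕ → ℤ := fun i => if hi : i < 2 ^ m then a' (e.symm ⟨i, hi⟩) else 0 with hb
  have hbe : ∀ l : Fin (2 ^ m), b (e l) = a' l := by
    intro l
    simp [hb]
  have hprod : ∏ i ∈ Finset.range (2 ^ m), d hα (3 ^ i) ^ b i =
      ∏ l ∈ Finset.range (2 ^ m - 1), d hα (2 * (l : ℕ) + 1) ^ a l := by
    calc ∏ i ∈ Finset.range (2 ^ m), d hα (3 ^ i) ^ b i
        = ∏ i : Fin (2 ^ m), d hα (3 ^ (i : ℕ)) ^ b i := Finset.prod_range _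
      _ = ∏ l : Fin (2 ^ m), d hα (3 ^ (e l : ℕ)) ^ b (e l) := (Equiv.prod_comp e _).symm
      _ = ∏ l : Fin (2 ^ m), d hα (2 * (l : ℕ) + 1) ^ a' l :=
          Finset.prod_congr rfl fun l _ => by rw [he, hbe]
      _ = ∏ l ∈ Finset.range (2 ^ m), d hα (2 * (l : ℕ) + 1) ^ a' l :=
          (Finset.prod_range (fun l => d hα (2 * (l : ℕ) + 1) ^ a' l)).symm
      _ = ∏ l ∈ Finset.range (2 ^ m - 1 + 1), d hα (2 * (l : ℕ) + 1) ^ a' l := by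
          rw [Nat.sub_add_cancel hpos]
      _ = _ := by
          rw [Finset.prod_range_succ]
          simp only [ha', lt_irrefl, if_false, zpow_zero, mul_one]
          exact Finset.prod_congr rfl fun l hl => by rw [if_pos (Finset.mem_range.1 hl)]
  rw [← hprod] at h
  have hα' : IsPrimitiveRoot (α : ℂ) (2 ^ (m + 2)) := IsPrimitiveRoot.coe_units_iff.2 hα
  have hconst := exponent_eq_of_relation hα' s b (by
    have h' := congrArg Units.val h
    rw [Units.val_mul, Units.val_zpow_eq_zpow_val, Units.coe_prod, Units.val_one] at h'
    refine Eq.trans ?_ h'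
    congr 1
    refine Finset.prod_congr rfl fun i _ => ?_
    rw [Units.val_zpow_eq_zpow_val, d_val, ← zpow_natCast (α : ℂ)]
    push_cast
    rfl)
  have hall : ∀ l : Fin (2 ^ m), a' l = b 0 := fun l => by rw [← hbe, hconst _ (e l).2]
  intro l hl
  have h1 := hall ⟨l, by omega⟩
  have h2 := hall ⟨2 ^ m - 1, by omega⟩
  simp only [ha', if_pos hl, lt_irrefl, if_false] at h1 h2
  rw [h1, ← h2]

/-! ### Generation of `P` by `α`, `D` and `1 - α` -/

theorem neg_one_mem_zpowers {m : ℕ} {α : ℂˣ} (hα : IsPrimitiveRoot α (2 ^ (m + 2))) :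
    (-1 : ℂˣ) ∈ Subgroup.zpowers α := by
  refine ⟨((2 ^ (m + 1) : ℕ) : ℤ), ?_⟩
  have h := (IsPrimitiveRoot.coe_units_iff.2 hα).pow_two_pow_half
  change α ^ ((2 ^ (m + 1) : ℕ) : ℤ) = -1
  rw [zpow_natCast]
  exact Units.ext (by rw [Units.val_pow_eq_pow_val, h, Units.val_neg, Units.val_one])

theorem one_sub_three_pow {n : ℕ} {α π : ℂˣ} (hα : IsPrimitiveRoot α (2 ^ n))
    (hπ : (π : ℂ) = 1 - α) (r : ℕ) :
    ∃ z ∈ Subgroup.zpowers α,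
      1 - (α : ℂ) ^ 3 ^ r = ((z * ∏ i ∈ Finset.range r, d hα (3 ^ i)) * π : ℂˣ) := by
  induction r with
  | zero => exact ⟨1, one_mem _, by simp [hπ]⟩
  | succ r ih =>
    obtain ⟨z, hz, h⟩ := ih
    refine ⟨z * α ^ 3 ^ r, mul_mem hz (pow_mem (Subgroup.mem_zpowers α) _), ?_⟩
    have hx0 : (α : ℂ) ^ 3 ^ r ≠ 0 := pow_ne_zero _ α.ne_zero
    have hd : (d hα (3 ^ r) : ℂ) = 1 + (α : ℂ) ^ 3 ^ r + ((α : ℂ) ^ 3 ^ r)⁻¹ := by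
      rw [d_val, ← zpow_natCast (α : ℂ)]
      push_cast
      rfl
    rw [Finset.prod_range_succ]
    calc 1 - (α : ℂ) ^ 3 ^ (r + 1)
        = (1 - (α : ℂ) ^ 3 ^ r) * ((α : ℂ) ^ 3 ^ r * d hα (3 ^ r)) := by
          rw [hd, pow_succ, pow_mul]
          field_simp
          ring
      _ = _ := by
          rw [h]
          push_cast
          ring

/-- Telescoping over a full cycle returns to `1 - α ^ (±1)`, which is `1 - α` up to a factor in
`⟨α⟩`. This makes the last `d_{2l+1}` redundant. -/
theorem prod_d_mem_zpowers {m : ℕ} {α : ℂˣ} (hα : IsPrimitiveRoot α (2 ^ (m + 2))) :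
    ∏ l ∈ Finset.range (2 ^ m), d hα (2 * (l : ℕ) + 1) ∈ Subgroup.zpowers α := by
  have hα' : IsPrimitiveRoot (α : ℂ) (2 ^ (m + 2)) := IsPrimitiveRoot.coe_units_iff.2 hα
  have h1 : (1 : ℂ) - α ≠ 0 := sub_ne_zero.2 (hα'.ne_one (Nat.one_lt_two_pow (by omega))).symm
  set π := Units.mk0 _ h1 with hπ
  obtain ⟨e, he⟩ := exists_equiv_d_three_pow hα
  have hprod : ∏ l ∈ Finset.range (2 ^ m), d hα (2 * (l : ℕ) + 1) =
      ∏ i ∈ Finset.range (2 ^ m), d hα (3 ^ i) := by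
    rw [Finset.prod_range, Finset.prod_range,
      ← Equiv.prod_comp e (fun i : Fin (2 ^ m) => d hα (3 ^ (i : ℕ)))]
    exact Finset.prod_congr rfl fun l _ => (he l).symm
  rw [hprod]
  obtain ⟨z, hz, h⟩ := one_sub_three_pow hα (π := π) rfl (2 ^ m)
  refine ((Subgroup.zpowers α).mul_mem_cancel_left hz).1 ?_
  rcases pow_three_pow_two_pow_eq hα'.pow_eq_one with h3 | h3 <;> rw [h3] at h
  · have : z * ∏ i ∈ Finset.range (2 ^ m), d hα (3 ^ i) = 1 :=
      mul_right_cancel (b := π) (by rw [one_mul]; exact Units.ext h.symm)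
    rw [this]
    exact one_mem _
  · have : z * ∏ i ∈ Finset.range (2 ^ m), d hα (3 ^ i) = -1 * α⁻¹ := by
      refine mul_right_cancel (b := π) (Units.ext (h.symm.trans ?_))
      have hα0 : (α : ℂ) ≠ 0 := α.ne_zero
      simp only [hπ, Units.val_mul, Units.val_neg, Units.val_one, Units.val_inv_eq_inv_val,
        Units.val_mk0]
      field_simp
      ring
    rw [this]
    exact mul_mem (neg_one_mem_zpowers hα) (inv_mem (Subgroup.mem_zpowers α))

theorem mem_D_iff {m : ℕ} {α : ℂˣ} (hα : IsPrimitiveRoot α (2 ^ (m + 2))) (x : ℂˣ) :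
    x ∈ D hα ↔
      ∃ a : Fin (2 ^ m - 1) → ℤ, ∏ l : Fin (2 ^ m - 1), d hα (2 * (l : ℕ) + 1) ^ a l = x := by
  rw [D]
  exact Subgroup.mem_closure_range_iff_of_fintype.trans
    ⟨fun ⟨a, h⟩ => ⟨a, h.symm⟩, fun ⟨a, h⟩ => ⟨a, h.symm⟩⟩

theorem d_mem_sup {m : ℕ} {α : ℂˣ} (hα : IsPrimitiveRoot α (2 ^ (m + 2))) {j : ℤ}
    (hj : Odd j) : d hα j ∈ Subgroup.zpowers α ⊔ D hα := by
  have hpos : 0 < 2 ^ m := by positivity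
  have hgen : ∀ l < 2 ^ m - 1, d hα (2 * (l : ℕ) + 1) ∈ Subgroup.zpowers α ⊔ D hα :=
    fun l hl => Subgroup.mem_sup_right (Subgroup.subset_closure ⟨⟨l, hl⟩, rfl⟩)
  have hall : ∀ l < 2 ^ m, d hα (2 * (l : ℕ) + 1) ∈ Subgroup.zpowers α ⊔ D hα := by
    intro l hl
    by_cases hl' : l < 2 ^ m - 1
    · exact hgen l hl'
    · have h := Subgroup.mem_sup_left (T := D hα) (prod_d_mem_zpowers hα)
      rw [← Nat.sub_add_cancel hpos, Finset.prod_range_succ] at h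
      rw [show l = 2 ^ m - 1 by omega]
      exact (Subgroup.mul_mem_cancel_left _
        (prod_mem fun l hl => hgen l (Finset.mem_range.1 hl))).1 h
  obtain ⟨i, hi, hdvd⟩ := exists_three_pow_dvd m j hj
  obtain ⟨e, he⟩ := exists_equiv_d_three_pow hα
  have := he (e.symm ⟨i, hi⟩)
  rw [Equiv.apply_symm_apply] at this
  rw [← d_eq_of_dvd hα hdvd, this]
  exact hall _ (e.symm ⟨i, hi⟩).2

/-- For odd exponents, reduce to `±3 ^ i` and telescope; each further factor 2 comes from `1 - x ^ 2
= (1 - x) * (1 - (-x))`. -/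
theorem one_sub_zpow_eq {m : ℕ} {α π : ℂˣ} (hα : IsPrimitiveRoot α (2 ^ (m + 2)))
    (hπ : (π : ℂ) = 1 - α) (v : ℕ) (hv : v ≤ m + 1) : ∀ k : ℤ, Odd k →
    ∃ w ∈ Subgroup.zpowers α ⊔ D hα,
      1 - (α : ℂ) ^ ((2 : ℤ) ^ v * k) = (w * π ^ 2 ^ v : ℂˣ) := by
  have hα' : IsPrimitiveRoot (α : ℂ) (2 ^ (m + 2)) := IsPrimitiveRoot.coe_units_iff.2 hα
  have hα0 : (α : ℂ) ≠ 0 := α.ne_zero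
  induction v with
  | zero =>
    intro k hk
    rw [pow_zero, one_mul, pow_zero, pow_one]
    obtain ⟨i, hi, hdvd⟩ := exists_three_pow_dvd m k hk
    obtain ⟨z, hz, h⟩ := one_sub_three_pow hα hπ i
    have hw : z * ∏ i ∈ Finset.range i, d hα (3 ^ i) ∈ Subgroup.zpowers α ⊔ D hα :=
      mul_mem (Subgroup.mem_sup_left hz)
        (prod_mem fun i _ => d_mem_sup hα (Odd.pow (by decide)))
    have hcast : (α : ℂ) ^ 3 ^ i = (α : ℂ) ^ ((3 : ℤ) ^ i) := by
      rw [← zpow_natCast]; push_cast; rfl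
    rcases hdvd with hd | hd
    · have h1 := (hα'.zpow_eq_one_iff_dvd ((3 : ℤ) ^ i - k)).2 (by exact_mod_cast hd)
      rw [zpow_sub₀ hα0, div_eq_one_iff_eq (zpow_ne_zero _ hα0)] at h1
      exact ⟨_, hw, by rw [← h1, ← hcast, h]⟩
    · have h1 := (hα'.zpow_eq_one_iff_dvd ((3 : ℤ) ^ i + k)).2 (by exact_mod_cast hd)
      rw [zpow_add₀ hα0] at h1
      refine ⟨-1 * α ^ k * _, mul_mem (Subgroup.mem_sup_left
        (mul_mem (neg_one_mem_zpowers hα) (zpow_mem (Subgroup.mem_zpowers α) k))) hw, ?_⟩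
      rw [mul_assoc, Units.val_mul, ← h, hcast, eq_inv_of_mul_eq_one_left h1]
      have : (α : ℂ) ^ k ≠ 0 := zpow_ne_zero _ hα0
      push_cast
      field_simp
      ring
  | succ v ih =>
    intro k hk
    have ih := ih (by omega)
    obtain ⟨w₁, hw₁, h₁⟩ := ih k hk
    -- Adding `2 ^ (m + 1 - v)` to `k` adds `2 ^ (m + 1)` to the exponent, which negates the power;
    -- the cofactor stays odd because `v ≤ m` here.
    obtain ⟨w₂, hw₂, h₂⟩ := ih (k + 2 ^ (m + 1 - v)) (hk.add_even (by
      rw [show m + 1 - v = m - v + 1 by omega, pow_succ]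
      exact even_two.mul_left _))
    refine ⟨w₁ * w₂, mul_mem hw₁ hw₂, ?_⟩
    have hneg : (α : ℂ) ^ ((2 : ℤ) ^ v * (k + 2 ^ (m + 1 - v))) = -(α : ℂ) ^ ((2 : ℤ) ^ v * k) := by
      rw [mul_add, ← pow_add, show v + (m + 1 - v) = m + 1 by omega, zpow_add₀ hα0]
      have h := hα'.pow_two_pow_half
      rw [← zpow_natCast] at h
      push_cast at h
      rw [h, mul_neg_one]
    rw [hneg] at h₂
    calc 1 - (α : ℂ) ^ ((2 : ℤ) ^ (v + 1) * k)
        = (1 - (α : ℂ) ^ ((2 : ℤ) ^ v * k)) * (1 - -(α : ℂ) ^ ((2 : ℤ) ^ v * k)) := by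
          rw [show (2 : ℤ) ^ (v + 1) * k = (2 : ℤ) ^ v * k * (2 : ℕ) by push_cast; ring,
            zpow_mul, zpow_natCast]
          ring
      _ = _ := by
          rw [h₁, h₂]
          push_cast
          ring

theorem mem_P_imp {m : ℕ} {α π : ℂˣ} (hα : IsPrimitiveRoot α (2 ^ (m + 2)))
    (hπ : (π : ℂ) = 1 - α) {x : ℂˣ} (hx : x ∈ P (m + 2) α) :
    ∃ w ∈ Subgroup.zpowers α ⊔ D hα, ∃ r : ℤ, x = w * π ^ r := by
  have hle : P (m + 2) α ≤ (Subgroup.zpowers α ⊔ D hα) ⊔ Subgroup.zpowers π := by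
    rw [P, Subgroup.closure_le]
    rintro u ⟨k, hk1, hk2, hu⟩
    obtain ⟨v, k', hk', rfl⟩ := Nat.exists_eq_two_pow_mul_odd (n := k) (by omega)
    have hv : v ≤ m + 1 := by
      have h1 : 2 ^ v ≤ 2 ^ v * k' := Nat.le_mul_of_pos_right _ hk'.pos
      have h0 : 0 < 2 ^ (m + 2) := by positivity
      have h2 : 2 ^ v < 2 ^ (m + 2) := by omega
      have := (Nat.pow_lt_pow_iff_right (by norm_num : 1 < 2)).1 h2
      omega
    obtain ⟨w, hw, h⟩ := one_sub_zpow_eq hα hπ v hv k' (by exact_mod_cast hk')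
    have : u = w * π ^ 2 ^ v := by
      ext
      rw [hu, ← h, ← zpow_natCast]
      push_cast
      rfl
    rw [this]
    exact mul_mem (Subgroup.mem_sup_left hw)
      (Subgroup.mem_sup_right (pow_mem (Subgroup.mem_zpowers π) _))
  obtain ⟨w, hw, y, ⟨r, rfl⟩, rfl⟩ := Subgroup.mem_sup.1 (hle hx)
  exact ⟨w, hw, r, rfl⟩

/-! ### Units of `ℤ[α]` and elements of `P` -/

theorem mem_unitsZ_iff {α x : ℂˣ} : x ∈ unitsZ α ↔
    (x : ℂ) ∈ Algebra.adjoin ℤ {(α : ℂ)} ∧ ((x⁻¹ : ℂˣ) : ℂ) ∈ Algebra.adjoin ℤ {(α : ℂ)} := by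
  constructor
  · rintro ⟨u, rfl⟩
    exact ⟨(u : Algebra.adjoin ℤ {(α : ℂ)}).2, (u⁻¹ : (Algebra.adjoin ℤ {(α : ℂ)})ˣ).val.2⟩
  · rintro ⟨h1, h2⟩
    exact ⟨⟨⟨x, h1⟩, ⟨_, h2⟩, Subtype.ext (by simp), Subtype.ext (by simp)⟩, Units.ext rfl⟩

theorem self_mem_unitsZ {n : ℕ} {α : ℂˣ} (hα : IsPrimitiveRoot α (2 ^ n)) : α ∈ unitsZ α := by
  have h : (α : ℂ) ∈ Algebra.adjoin ℤ {(α : ℂ)} := Algebra.self_mem_adjoin_singleton ℤ _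
  refine mem_unitsZ_iff.2 ⟨h, ?_⟩
  have : α⁻¹ = α ^ (2 ^ n - 1) := by
    refine inv_eq_of_mul_eq_one_right ?_
    rw [← pow_succ', Nat.sub_add_cancel Nat.one_le_two_pow, hα.pow_eq_one]
  rw [this, Units.val_pow_eq_pow_val]
  exact pow_mem h _

theorem zpow_ne_one_of_odd {m : ℕ} {α : ℂ} (hα : IsPrimitiveRoot α (2 ^ (m + 2))) {j : ℤ}
    (hj : Odd j) : α ^ j ≠ 1 := by
  intro h
  have h1 := (hα.zpow_eq_one_iff_dvd _).1 h
  refine (Int.not_even_iff_odd.2 hj) (even_iff_two_dvd.2 (dvd_trans ?_ h1))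
  push_cast
  exact dvd_pow_self _ (by omega)

theorem d_mem_unitsZ {m : ℕ} {α : ℂˣ} (hα : IsPrimitiveRoot α (2 ^ (m + 2))) {j : ℤ}
    (hj : Odd j) : d hα j ∈ unitsZ α := by
  have hα' : IsPrimitiveRoot (α : ℂ) (2 ^ (m + 2)) := IsPrimitiveRoot.coe_units_iff.2 hα
  obtain ⟨h1, h2⟩ := mem_unitsZ_iff.1 (zpow_mem (self_mem_unitsZ hα) j)
  have hy1 : (α : ℂ) ^ j ≠ 1 := zpow_ne_one_of_odd hα' hj
  have hy : ((α : ℂ) ^ j) ^ 2 ^ (m + 2) = 1 := by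
    rw [← zpow_natCast, zpow_comm, zpow_natCast, hα'.pow_eq_one, one_zpow]
  rw [Units.val_inv_eq_inv_val, Units.val_zpow_eq_zpow_val] at h2
  rw [Units.val_zpow_eq_zpow_val] at h1
  refine mem_unitsZ_iff.2 ⟨?_, ?_⟩
  · rw [d_val]
    exact add_mem (add_mem (one_mem _) h1) h2
  · have hd := d_val hα j
    generalize (α : ℂ) ^ j = y at *
    have hy0 : y ≠ 0 := by
      rintro rfl
      simp at hy
    obtain ⟨t, ht⟩ : ∃ t, (y ^ 3) ^ t = y := by
      -- Raising to the power `3 ^ 2 ^ m` is the identity or inversion on `y`, so doing it twice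
      -- fixes `y`. Then `(1 - y) / (1 - y ^ 3)` is a geometric sum in `y ^ 3`.
      refine ⟨3 ^ (2 ^ m * 2 - 1), ?_⟩
      have hp : 0 < 2 ^ m := by positivity
      rw [← pow_mul, ← pow_succ', Nat.sub_add_cancel (by omega), mul_two, pow_add, pow_mul]
      have hy' : (y ^ 3 ^ 2 ^ m) ^ 2 ^ (m + 2) = 1 := by
        rw [← pow_mul, mul_comm, pow_mul, hy, one_pow]
      rcases pow_three_pow_two_pow_eq hy with h | h
      · rw [h, h]
      · rw [h, inv_pow, h, inv_inv]
    have hinv : ((d hα j)⁻¹ : ℂˣ) = y * ∑ i ∈ Finset.range t, (y ^ 3) ^ i := by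
      rw [Units.val_inv_eq_inv_val]
      refine inv_eq_of_mul_eq_one_right ?_
      have hg := mul_neg_geom_sum (y ^ 3) t
      rw [ht] at hg
      rw [hd]
      refine mul_left_cancel₀ (sub_ne_zero.2 hy1.symm) ?_
      rw [mul_one]
      refine Eq.trans ?_ hg
      field_simp
      ring
    rw [hinv]
    exact mul_mem h1 (sum_mem fun i _ => pow_mem (pow_mem h1 _) _)

theorem sup_le_unitsZ {m : ℕ} {α : ℂˣ} (hα : IsPrimitiveRoot α (2 ^ (m + 2))) :
    Subgroup.zpowers α ⊔ D hα ≤ unitsZ α := by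
  refine sup_le (Subgroup.zpowers_le.2 (self_mem_unitsZ hα)) ?_
  rw [D, Subgroup.closure_le]
  rintro _ ⟨l, rfl⟩
  exact d_mem_unitsZ hα ⟨_, rfl⟩

theorem one_sub_zpow_mem_P {n : ℕ} {α : ℂˣ} (hα : IsPrimitiveRoot α (2 ^ n)) {u : ℂˣ} (j : ℤ)
    (hu : (u : ℂ) = 1 - (α : ℂ) ^ j) : u ∈ P n α := by
  have hα' : IsPrimitiveRoot (α : ℂ) (2 ^ n) := IsPrimitiveRoot.coe_units_iff.2 hα
  have hN : (0 : ℤ) < (2 ^ n : ℕ) := by positivity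
  have h0 := Int.emod_nonneg j hN.ne'
  have h1 := Int.emod_lt_of_pos j hN
  have hpow : (α : ℂ) ^ (j % (2 ^ n : ℕ)).toNat = (α : ℂ) ^ j := by
    rw [← zpow_natCast, Int.toNat_of_nonneg h0]
    conv_rhs => rw [← Int.emod_add_mul_ediv j (2 ^ n : ℕ)]
    rw [zpow_add₀ α.ne_zero, zpow_mul, zpow_natCast, hα'.pow_eq_one, one_zpow, mul_one]
  refine Subgroup.subset_closure ⟨(j % (2 ^ n : ℕ)).toNat, ?_, by omega, by rw [hpow, hu]⟩
  by_contra hlt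
  have h2 : (j % (2 ^ n : ℕ)).toNat = 0 := by omega
  rw [h2, pow_zero] at hpow
  rw [← hpow, sub_self] at hu
  exact u.ne_zero hu

/-- Uses `-α ^ j = (1 - α ^ j) / (1 - α ^ (-j))`, `α = (-α ^ 2) / (-α)` and `d_j = (1 - α ^ (3 * j))
/ ((1 - α ^ j) * α ^ j)`. -/
theorem sup_le_P {m : ℕ} {α : ℂˣ} (hα : IsPrimitiveRoot α (2 ^ (m + 2))) :
    Subgroup.zpowers α ⊔ D hα ≤ P (m + 2) α := by
  have hα' : IsPrimitiveRoot (α : ℂ) (2 ^ (m + 2)) := IsPrimitiveRoot.coe_units_iff.2 hα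
  have hα0 : (α : ℂ) ≠ 0 := α.ne_zero
  have hneg : ∀ j : ℤ, (α : ℂ) ^ j ≠ 1 → -(α ^ j) ∈ P (m + 2) α := by
    intro j hj
    have h1 : (1 : ℂ) - (α : ℂ) ^ j ≠ 0 := sub_ne_zero.2 hj.symm
    have h2 : (1 : ℂ) - (α : ℂ) ^ (-j) ≠ 0 := by
      rw [zpow_neg]
      exact sub_ne_zero.2 fun h => hj (inv_eq_one.1 h.symm)
    have h := div_mem (one_sub_zpow_mem_P hα (u := Units.mk0 _ h1) j rfl)
      (one_sub_zpow_mem_P hα (u := Units.mk0 _ h2) (-j) rfl)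
    convert h using 1
    rw [eq_div_iff_mul_eq']
    ext
    have : (α : ℂ) ^ j ≠ 0 := zpow_ne_zero _ hα0
    simp only [Units.val_mul, Units.val_neg, Units.val_mk0, Units.val_zpow_eq_zpow_val, zpow_neg]
    field_simp
    ring
  have hself : α ∈ P (m + 2) α := by
    have h2 : (α : ℂ) ^ (2 : ℤ) ≠ 1 := by
      intro h
      have := Int.le_of_dvd (by norm_num) ((hα'.zpow_eq_one_iff_dvd _).1 h)
      have hp : 0 < 2 ^ m := by positivity
      rw [pow_add] at this
      omega
    have h := div_mem (hneg 2 h2) (hneg 1 (zpow_ne_one_of_odd hα' odd_one))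
    convert h using 1
    rw [neg_div_neg_eq, div_eq_mul_inv, ← zpow_sub]
    norm_num
  refine sup_le (Subgroup.zpowers_le.2 hself) ?_
  rw [D, Subgroup.closure_le]
  rintro _ ⟨l, rfl⟩
  change d hα (2 * ((l : ℕ) : ℤ) + 1) ∈ P (m + 2) α
  have hodd : Odd (2 * ((l : ℕ) : ℤ) + 1) := ⟨_, rfl⟩
  generalize 2 * ((l : ℕ) : ℤ) + 1 = j at hodd
  have h1 : (1 : ℂ) - (α : ℂ) ^ j ≠ 0 := sub_ne_zero.2 (zpow_ne_one_of_odd hα' hodd).symm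
  have h3 : (1 : ℂ) - (α : ℂ) ^ (3 * j) ≠ 0 :=
    sub_ne_zero.2 (zpow_ne_one_of_odd hα' ((by decide : Odd (3 : ℤ)).mul hodd)).symm
  have h := div_mem (one_sub_zpow_mem_P hα (u := Units.mk0 _ h3) (3 * j) rfl)
    (mul_mem (one_sub_zpow_mem_P hα (u := Units.mk0 _ h1) j rfl) (zpow_mem hself j))
  convert h using 1
  rw [eq_div_iff_mul_eq']
  ext
  have : (α : ℂ) ^ j ≠ 0 := zpow_ne_zero _ hα0
  simp only [Units.val_mul, Units.val_mk0, Units.val_zpow_eq_zpow_val, d_val, mul_comm 3 j,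
    zpow_mul]
  rw [show (3 : ℤ) = ((3 : ℕ) : ℤ) by rfl, zpow_natCast]
  field_simp
  ring

/-! ### Eliminating `1 - α` and determining `K` -/

theorem two_inv_not_isIntegral : ¬ IsIntegral ℤ ((2 : ℂ)⁻¹) := by
  intro h
  have h1 : IsIntegral ℤ ((2 : ℚ)⁻¹) := by
    rw [← isIntegral_algebraMap_iff (algebraMap ℚ ℂ).injective]
    simpa using h
  obtain ⟨z, hz⟩ := IsIntegrallyClosed.isIntegral_iff.1 h1
  have h2 : (z : ℚ) * 2 = 1 := by
    rw [show (z : ℚ) = 2⁻¹ from hz]; norm_num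
  have h3 : z * 2 = 1 := by exact_mod_cast h2
  omega

/-- No nontrivial power of `1 - α` is a unit of `ℤ[α]`. -/
theorem eq_zero_of_zpow_mem_unitsZ {m : ℕ} {α π : ℂˣ} (hα : IsPrimitiveRoot α (2 ^ (m + 2)))
    (hπ : (π : ℂ) = 1 - α) {r : ℤ} (hr : π ^ r ∈ unitsZ α) : r = 0 := by
  have hα' : IsPrimitiveRoot (α : ℂ) (2 ^ (m + 2)) := IsPrimitiveRoot.coe_units_iff.2 hα
  by_contra hr0
  -- Since `α ^ 2 ^ (m + 1) = -1`, this writes 2 as a unit times `π ^ 2 ^ (m + 1)`; if `π ^ r` is a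
  -- unit, so is `2 ^ r`.
  obtain ⟨w, hw, h⟩ := one_sub_zpow_eq hα hπ (m + 1) le_rfl 1 odd_one
  have hhalf := hα'.pow_two_pow_half
  rw [← zpow_natCast] at hhalf
  push_cast at hhalf
  rw [mul_one, hhalf] at h
  set τ : ℂˣ := w * π ^ 2 ^ (m + 1) with hτ
  have hτ2 : (τ : ℂ) = 2 := by rw [← h]; norm_num
  have hmem : τ ^ r ∈ unitsZ α := by
    rw [hτ, mul_zpow, ← zpow_natCast, zpow_comm]
    exact mul_mem (zpow_mem (sup_le_unitsZ hα hw) _) (zpow_mem hr _)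
  have hnat : τ ^ r.natAbs ∈ unitsZ α := by
    rcases Int.natAbs_eq r with h | h
    · rw [h, zpow_natCast] at hmem
      exact hmem
    · rw [h, zpow_neg, zpow_natCast] at hmem
      exact inv_mem_iff.1 hmem
  have hle : ∀ y ∈ Algebra.adjoin ℤ {(α : ℂ)}, IsIntegral ℤ y :=
    fun y hy => adjoin_le_integralClosure (hα'.isIntegral (by positivity)) hy
  have hint := hle _ (mem_unitsZ_iff.1 hnat).2
  obtain ⟨c, hc⟩ := Nat.exists_eq_succ_of_ne_zero (Int.natAbs_ne_zero.2 hr0)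
  refine two_inv_not_isIntegral ?_
  have h2 : IsIntegral ℤ ((2 : ℂ) ^ c) := (isIntegral_algebraMap (x := (2 : ℤ))).pow c
  refine (?_ : (2 : ℂ)⁻¹ = 2 ^ c * ((τ ^ r.natAbs)⁻¹ : ℂˣ)) ▸ h2.mul hint
  rw [Units.val_inv_eq_inv_val, Units.val_pow_eq_pow_val, hτ2, hc, pow_succ]
  field_simp

theorem mem_K_iff {m : ℕ} {α : ℂˣ} (hα : IsPrimitiveRoot α (2 ^ (m + 2))) (x : ℂˣ) :
    x ∈ K (m + 2) α ↔ ∃ y ∈ Subgroup.zpowers α, ∃ z ∈ D hα, y * z = x := by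
  have hα' : IsPrimitiveRoot (α : ℂ) (2 ^ (m + 2)) := IsPrimitiveRoot.coe_units_iff.2 hα
  have h1 : (1 : ℂ) - α ≠ 0 := sub_ne_zero.2 (hα'.ne_one (Nat.one_lt_two_pow (by omega))).symm
  rw [← Subgroup.mem_sup]
  refine ⟨fun ⟨hP, hU⟩ => ?_, fun h => ⟨sup_le_P hα h, sup_le_unitsZ hα h⟩⟩
  obtain ⟨w, hw, r, rfl⟩ := mem_P_imp hα (π := Units.mk0 _ h1) rfl hP
  have hr := eq_zero_of_zpow_mem_unitsZ hα (π := Units.mk0 _ h1) rfl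
    ((Subgroup.mul_mem_cancel_left _ (sup_le_unitsZ hα hw)).1 hU)
  rw [hr, zpow_zero, mul_one]
  exact hw

/-! ### Real elements -/

theorem D_le_realUnits {n : ℕ} {α : ℂˣ} (hα : IsPrimitiveRoot α (2 ^ n)) :
    D hα ≤ realUnits := by
  rw [D, Subgroup.closure_le]
  rintro _ ⟨l, rfl⟩
  change d hα (2 * ((l : ℕ) : ℤ) + 1) ∈ realUnits
  generalize 2 * ((l : ℕ) : ℤ) + 1 = j
  have hα' : IsPrimitiveRoot (α : ℂ) (2 ^ n) := IsPrimitiveRoot.coe_units_iff.2 hα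
  have hnorm : ‖(α : ℂ) ^ j‖ = 1 := by
    rw [norm_zpow, hα'.norm'_eq_one (by positivity), one_zpow]
  have hd : (d hα j : ℂ) = ((1 + 2 * ((α : ℂ) ^ j).re : ℝ) : ℂ) := by
    rw [d_val, Complex.inv_def, Complex.normSq_eq_norm_sq, hnorm]
    have h := Complex.add_conj ((α : ℂ) ^ j)
    push_cast at h ⊢
    linear_combination h
  have h0 : 1 + 2 * ((α : ℂ) ^ j).re ≠ 0 := by
    intro h0
    rw [h0, Complex.ofReal_zero] at hd
    exact (d hα j).ne_zero hd
  exact ⟨Units.mk0 _ h0, Units.ext hd.symm⟩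

theorem mem_zpowers_neg_one_of_real {n : ℕ} {α : ℂˣ} (hα : IsPrimitiveRoot α (2 ^ n)) {x : ℂˣ}
    (hx : x ∈ Subgroup.zpowers α) (hr : x ∈ realUnits) : x ∈ Subgroup.zpowers (-1 : ℂˣ) := by
  obtain ⟨j, rfl⟩ := hx
  obtain ⟨y, hy⟩ := hr
  have hα' : IsPrimitiveRoot (α : ℂ) (2 ^ n) := IsPrimitiveRoot.coe_units_iff.2 hα
  have hval : ((y : ℝ) : ℂ) = (α : ℂ) ^ j := by
    simpa using congrArg Units.val hy
  have hnorm : ‖((y : ℝ) : ℂ)‖ = 1 := by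
    rw [hval, norm_zpow, hα'.norm'_eq_one (by positivity), one_zpow]
  rw [Complex.norm_real, Real.norm_eq_abs] at hnorm
  change α ^ j ∈ _
  rcases eq_or_eq_neg_of_abs_eq hnorm with h | h
  · have : α ^ j = 1 := by
      ext; rw [Units.val_zpow_eq_zpow_val, ← hval, h]; simp
    rw [this]
    exact one_mem _
  · have : α ^ j = -1 := by
      ext; rw [Units.val_zpow_eq_zpow_val, ← hval, h]; simp
    rw [this]
    exact Subgroup.mem_zpowers _

theorem eq_one_of_zpow_mul_prod_eq_one {m : ℕ} {α : ℂˣ} (hα : IsPrimitiveRoot α (2 ^ (m + 2)))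
    {y : ℂˣ} (hy : y ∈ Subgroup.zpowers α) (a : Fin (2 ^ m - 1) → ℤ)
    (h : y * ∏ l : Fin (2 ^ m - 1), d hα (2 * (l : ℕ) + 1) ^ a l = 1) : y = 1 ∧ ∀ l, a l = 0 := by
  obtain ⟨s, rfl⟩ := hy
  have ha : ∀ l, a l = 0 := by
    have h0 := exponent_eq_zero hα s (fun l => if hl : l < 2 ^ m - 1 then a ⟨l, hl⟩ else 0) (by
      rw [Finset.prod_range, ← h]
      congr 1
      exact Finset.prod_congr rfl fun l _ => by simp)
    intro l
    simpa using h0 l l.2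
  refine ⟨?_, ha⟩
  simpa [ha] using h

theorem eq_one_of_mul_eq_one {m : ℕ} {α : ℂˣ} (hα : IsPrimitiveRoot α (2 ^ (m + 2)))
    {y z : ℂˣ} (hy : y ∈ Subgroup.zpowers α) (hz : z ∈ D hα) (h : y * z = 1) :
    y = 1 ∧ z = 1 := by
  obtain ⟨a, rfl⟩ := (mem_D_iff hα z).1 hz
  have := (eq_one_of_zpow_mul_prod_eq_one hα hy a h).1
  exact ⟨this, by rwa [this, one_mul] at h⟩

end TwoPowerCyclotomic

/-! ### The direct product decompositions -/

open TwoPowerCyclotomic in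
theorem isInternalDirectProduct_D {m : ℕ} {α : ℂˣ} (hα : IsPrimitiveRoot α (2 ^ (m + 2))) :
    IsInternalDirectProduct (D hα)
      (fun l : Fin (2 ^ m - 1) => Subgroup.zpowers (d hα (2 * (l : ℕ) + 1))) := by
  refine .of_forall (fun f hf h => ?_) fun x => ?_
  · choose a ha using hf
    have h0 := (eq_one_of_zpow_mul_prod_eq_one hα (one_mem _) a
      (by rw [one_mul, ← h]; exact Finset.prod_congr rfl fun l _ => ha l)).2
    intro l
    rw [← ha l, h0 l]
    exact zpow_zero _
  · rw [mem_D_iff hα]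
    constructor
    · rintro ⟨a, rfl⟩
      exact ⟨_, fun l => ⟨a l, rfl⟩, rfl⟩
    · rintro ⟨f, hf, rfl⟩
      choose a ha using hf
      exact ⟨a, Finset.prod_congr rfl fun l _ => ha l⟩

open TwoPowerCyclotomic in
theorem isInternalDirectProduct_K_option {m : ℕ} {α : ℂˣ}
    (hα : IsPrimitiveRoot α (2 ^ (m + 2))) :
    IsInternalDirectProduct (K (m + 2) α)
      (fun o : Option (Fin (2 ^ m - 1)) =>
        o.elim (Subgroup.zpowers α) (fun l => Subgroup.zpowers (d hα (2 * (l : ℕ) + 1)))) := by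
  refine .of_forall (fun f hf h => ?_) fun x => ?_
  · have h1 := hf none
    choose a ha using fun l => hf (some l)
    rw [Fintype.prod_option] at h
    obtain ⟨h2, h0⟩ := eq_one_of_zpow_mul_prod_eq_one hα h1 a
      (by rw [← h]; congr 1; exact Finset.prod_congr rfl fun l _ => ha l)
    rintro (_ | l)
    · exact h2
    · rw [← ha l, h0 l]
      exact zpow_zero _
  · rw [mem_K_iff hα]
    constructor
    · rintro ⟨y, hy, z, hz, rfl⟩
      obtain ⟨a, rfl⟩ := (mem_D_iff hα z).1 hz
      refine ⟨fun o => o.elim y fun l => d hα (2 * (l : ℕ) + 1) ^ a l, ?_,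
        Fintype.prod_option _⟩
      rintro (_ | l)
      · exact hy
      · exact ⟨a l, rfl⟩
    · rintro ⟨f, hf, rfl⟩
      choose a ha using fun l => hf (some l)
      refine ⟨f none, hf none, _, (mem_D_iff hα _).2 ⟨a, rfl⟩, ?_⟩
      rw [Fintype.prod_option]
      congr 1
      exact Finset.prod_congr rfl fun l _ => ha l

theorem IsInternalDirectProduct.of_pair {G : Type*} [CommGroup G] {N A B : Subgroup G}
    (hinj : ∀ y ∈ A, ∀ z ∈ B, y * z = 1 → y = 1 ∧ z = 1)
    (hmem : ∀ x, x ∈ N ↔ ∃ y ∈ A, ∃ z ∈ B, y * z = x) : IsInternalDirectProduct N ![A, B] := by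
  refine .of_forall (fun f hf h => ?_) fun x => ?_
  · rw [Fin.prod_univ_two] at h
    obtain ⟨h0, h1⟩ := hinj _ (hf 0) _ (hf 1) h
    rw [Fin.forall_fin_two]
    exact ⟨h0, h1⟩
  · rw [hmem]
    constructor
    · rintro ⟨y, hy, z, hz, rfl⟩
      exact ⟨![y, z], by rw [Fin.forall_fin_two]; exact ⟨hy, hz⟩, by simp⟩
    · rintro ⟨f, hf, rfl⟩
      exact ⟨_, hf 0, _, hf 1, (Fin.prod_univ_two f).symm⟩

open TwoPowerCyclotomic in
theorem isInternalDirectProduct_K_inf_realUnits {m : ℕ} {α : ℂˣ}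
    (hα : IsPrimitiveRoot α (2 ^ (m + 2))) :
    IsInternalDirectProduct (K (m + 2) α ⊓ realUnits)
      ![Subgroup.zpowers (-1 : ℂˣ), D hα] := by
  have hle : Subgroup.zpowers (-1 : ℂˣ) ≤ Subgroup.zpowers α :=
    Subgroup.zpowers_le.2 (neg_one_mem_zpowers hα)
  have hreal : (-1 : ℂˣ) ∈ realUnits := ⟨-1, Units.ext (by simp)⟩
  refine .of_pair (fun y hy z hz h => eq_one_of_mul_eq_one hα (hle hy) hz h) fun x => ?_
  rw [Subgroup.mem_inf, mem_K_iff hα]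
  constructor
  · rintro ⟨⟨y, hy, z, hz, rfl⟩, hr⟩
    exact ⟨y, mem_zpowers_neg_one_of_real hα hy
      ((Subgroup.mul_mem_cancel_right _ (D_le_realUnits hα hz)).1 hr), z, hz, rfl⟩
  · rintro ⟨y, hy, z, hz, rfl⟩
    refine ⟨⟨y, hle hy, z, hz, rfl⟩, mul_mem ?_ (D_le_realUnits hα hz)⟩
    exact Subgroup.zpowers_le.2 hreal hy

theorem lemmal (n : ℕ) (hn : 2 ≤ n) (α : ℂˣ) (hα : IsPrimitiveRoot α (2 ^ n)) :
    -- `K(α) = ⟨α⟩ × ∏_{l=0}^{2^(n-2)-2} ⟨d_{2l+1}⟩`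
    IsInternalDirectProduct (TwoPowerCyclotomic.K n α)
      (fun o : Option (Fin (2 ^ (n - 2) - 1)) =>
        o.elim (Subgroup.zpowers α)
          (fun l => Subgroup.zpowers (TwoPowerCyclotomic.d hα (2 * (l : ℕ) + 1)))) ∧
    -- `D = ∏_{l=0}^{2^(n-2)-2} ⟨d_{2l+1}⟩`
    IsInternalDirectProduct (TwoPowerCyclotomic.D hα)
      (fun l : Fin (2 ^ (n - 2) - 1) =>
        Subgroup.zpowers (TwoPowerCyclotomic.d hα (2 * (l : ℕ) + 1))) ∧
    -- `K(α) = ⟨α⟩ × D`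
    IsInternalDirectProduct (TwoPowerCyclotomic.K n α)
      ![Subgroup.zpowers α, TwoPowerCyclotomic.D hα] ∧
    -- `K(α) ∩ ℝ = ⟨-1⟩ × D`
    IsInternalDirectProduct (TwoPowerCyclotomic.K n α ⊓ TwoPowerCyclotomic.realUnits)
      ![Subgroup.zpowers (-1 : ℂˣ), TwoPowerCyclotomic.D hα] := by
  obtain ⟨m, rfl⟩ := Nat.exists_eq_add_of_le' hn
  exact ⟨isInternalDirectProduct_K_option hα, isInternalDirectProduct_D hα,
    .of_pair (fun _ hy _ hz h => TwoPowerCyclotomic.eq_one_of_mul_eq_one hα hy hz h)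
      (TwoPowerCyclotomic.mem_K_iff hα),
    isInternalDirectProduct_K_inf_realUnits hα⟩
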